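/- Let $p$ be a prime, let $n\ge 2$ be an integer, and let $F=\mathbb{F}_{p^n}$ be a finite field with $p^n$ elements. A function $f\colon F\to F$ is called generalized almost perfect nonlinear (GAPN) if for all $a\in F\setminus\{0\}$ and all $b\in F$ $$\#\Big\{x\in F \;:\; \sum_{i\in\mathbb{F}_p} f(x+ia)=b\Big\}\le p .$$ Let $d=p^t+p+1$, where $t=(n-1)/2$ if $n$ is odd and $t=n/2$ if $n$ is even. Then the monomial function $f_d\colon F\to F$, $f_d(x)=x^d$, is GAPN on $F$ if and only if either $p=2$ and $n$ is odd, or $p=3$. -/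

import Mathlib

/-- The generalized derivative of `f : F → F` in direction `a`, for a field `F` over the prime
field `ZMod p`: it sends `x` to the sum of `f (x + i a)` over all `i` in the prime field. -/
def genDeriv (p : ℕ) [Fact p.Prime] {F : Type*} [Field F] [Algebra (ZMod p) F]
    (f : F → F) (a x : F) : F :=
  ∑ i : ZMod p, f (x + i • a)

/-- `f` is generalized almost perfect nonlinear: for every nonzero `a` and every `b`, the equation
`genDeriv p f a x = b` has at most `p` solutions `x` in the finite field `F`. -/
def IsGAPN (p : ℕ) [Fact p.Prime] {F : Type*} [Field F] [Finite F] [Algebra (ZMod p) F]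
    (f : F → F) : Prop :=
  ∀ a : F, a ≠ 0 → ∀ b : F, Set.ncard {x : F | genDeriv p f a x = b} ≤ p

/-- The exponent `t` attached to `n`: `(n - 1) / 2` for `n` odd and `n / 2` for `n` even. -/
def welchT (n : ℕ) : ℕ := if Odd n then (n - 1) / 2 else n / 2

/-! Expanding `(x + i • a) ^ d` gives a cubic in `i`, so the derivative is governed by the power
sums of `i` over the prime field. For `p ≥ 5` they all vanish, and all `p ^ n > p` points solve the
equation with `b = 0`. For `p = 3` only the `i ^ 2` term survives; it is additive in `x`, and its
kernel must be the line spanned by `a`. For `p = 2` and `n` even, a primitive cube root of unity is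
a third solution; for `n` odd, Dobbertin's injectivity argument applies. -/

/-- A set any two elements of which differ by a prime-field multiple of `a` has at most `p`
elements. -/
theorem ncard_le_of_sub_eq_smul (p : ℕ) [Fact p.Prime] {F : Type*} [Field F] [Finite F]
    [Algebra (ZMod p) F] (a : F) (S : Set F)
    (hS : ∀ x ∈ S, ∀ y ∈ S, ∃ i : ZMod p, y = x + i • a) : S.ncard ≤ p := by
  rcases S.eq_empty_or_nonempty with rfl | ⟨x, hx⟩
  · simp
  · have hsub : S ⊆ (fun i : ZMod p => x + i • a) '' Set.univ := by
      intro y hy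
      obtain ⟨i, hi⟩ := hS x hx y hy
      exact ⟨i, Set.mem_univ _, hi.symm⟩
    calc S.ncard ≤ ((fun i : ZMod p => x + i • a) '' Set.univ).ncard :=
          Set.ncard_le_ncard hsub (Set.toFinite _)
      _ ≤ (Set.univ : Set (ZMod p)).ncard := Set.ncard_image_le (Set.toFinite _)
      _ = p := by rw [Set.ncard_univ, Nat.card_zmod]

/-- The expansion of the power `p ^ t + p + 1` of `x + i • a` as a cubic in `i`. -/
theorem add_smul_pow_expansion (p : ℕ) [Fact p.Prime] {F : Type*} [Field F] [CharP F p]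
    [Algebra (ZMod p) F] (t : ℕ) (a x : F) (i : ZMod p) :
    (x + i • a) ^ (p ^ t + p + 1) =
      x ^ (p ^ t + p + 1)
      + i • (a ^ p ^ t * x ^ p * x + x ^ p ^ t * a ^ p * x + x ^ p ^ t * x ^ p * a)
      + i ^ 2 • (a ^ p ^ t * a ^ p * x + a ^ p ^ t * x ^ p * a + x ^ p ^ t * a ^ p * a)
      + i ^ 3 • a ^ (p ^ t + p + 1) := by
  have hq : (x + i • a) ^ p ^ t = x ^ p ^ t + i • a ^ p ^ t := by
    rw [add_pow_char_pow, smul_pow, ZMod.pow_card_pow]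
  have hp : (x + i • a) ^ p = x ^ p + i • a ^ p := by
    rw [add_pow_char, smul_pow, ZMod.pow_card]
  rw [pow_add, pow_add, hq, hp]
  simp only [Algebra.smul_def, map_pow]
  ring

theorem genDeriv_eq_zero_of_five_le (p : ℕ) [Fact p.Prime] {F : Type*} [Field F] [CharP F p]
    [Algebra (ZMod p) F] (hp : 5 ≤ p) (t : ℕ) (a x : F) :
    genDeriv p (fun x : F => x ^ (p ^ t + p + 1)) a x = 0 := by
  have hsum : ∀ k < p - 1, ∑ i : ZMod p, i ^ k = 0 := fun k hk =>
    FiniteField.sum_pow_lt_card_sub_one (ZMod p) k (by rwa [ZMod.card])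
  have h1 := hsum 1 (by omega)
  simp only [pow_one] at h1
  simp only [genDeriv, add_smul_pow_expansion, Finset.sum_add_distrib, ← Finset.sum_smul,
    hsum 2 (by omega), hsum 3 (by omega), h1]
  simp

/-- For `p = 3` the generalized derivative is additive in `x`. -/
theorem genDeriv_three {F : Type*} [Field F] [CharP F 3] [Algebra (ZMod 3) F] (t : ℕ)
    (a x : F) :
    genDeriv 3 (fun x : F => x ^ (3 ^ t + 3 + 1)) a x =
      -(a ^ 3 ^ t * a ^ 3 * x + a ^ 3 ^ t * x ^ 3 * a + x ^ 3 ^ t * a ^ 3 * a) := by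
  have h1 : ∑ i : ZMod 3, i = 0 := by decide
  have h2 : ∑ i : ZMod 3, i ^ 2 = -1 := by decide
  have h3 : ∑ i : ZMod 3, i ^ 3 = 0 := by decide
  have h0 : (3 : F) = 0 := CharP.cast_eq_zero F 3
  simp only [genDeriv, add_smul_pow_expansion, Finset.sum_add_distrib, ← Finset.sum_smul,
    h1, h2, h3]
  simp only [h0, zero_smul, add_zero, neg_smul, one_smul, Finset.sum_const,
    Finset.card_univ, ZMod.card, nsmul_eq_mul, Nat.cast_ofNat, zero_mul, zero_add]

/-- Here `σ : y ↦ y ^ 3 ^ t` is an involution. Applying it to `σ y = -y ^ 3 - y` yields `y ^ 9 = y ^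
3`, a perfect cube identity. -/
theorem cube_eq_self_of_even {F : Type*} [Field F] [CharP F 3] (t : ℕ)
    (hF : ∀ x : F, x ^ 3 ^ (t + t) = x) (y : F) (hy : y ^ 3 ^ t + y ^ 3 + y = 0) :
    y ^ 3 = y := by
  have h0 : (3 : F) = 0 := CharP.cast_eq_zero F 3
  let σ := iterateFrobenius F 3 t
  have hσ : ∀ x, σ x = x ^ 3 ^ t := fun x => iterateFrobenius_def 3 t x
  have hσσ : σ (σ y) = y := by rw [hσ, hσ, ← pow_mul, ← pow_add, hF]
  rw [← hσ] at hy
  have hσy : σ y = -y ^ 3 - y := by linear_combination hy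
  have h := hσσ
  rw [hσy, map_sub, map_neg, map_pow, hσy] at h
  have h9 : (y ^ 3 - y) ^ 3 = 0 := by
    linear_combination h + (-2 * y ^ 7 - y ^ 3) * h0
  exact sub_eq_zero.1 (pow_eq_zero_iff three_ne_zero |>.1 h9)

/-- Now `σ ^ 2` inverts Frobenius, and the same substitution gives `z ^ 9 = -z` for `z = y ^ 3 - y`.
-/
theorem cube_eq_self_of_odd {F : Type*} [Field F] [CharP F 3] (t : ℕ)
    (hF : ∀ x : F, x ^ 3 ^ (t + t + 1) = x) (y : F) (hy : y ^ 3 ^ t + y ^ 3 + y = 0) :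
    y ^ 3 = y := by
  have h0 : (3 : F) = 0 := CharP.cast_eq_zero F 3
  have hcube : ∀ u v : F, (u - v) ^ 3 = u ^ 3 - v ^ 3 := fun u v => by
    linear_combination (-u ^ 2 * v + u * v ^ 2) * h0
  let σ := iterateFrobenius F 3 t
  have hσ : ∀ x, σ x = x ^ 3 ^ t := fun x => iterateFrobenius_def 3 t x
  have hσσ : ∀ x, σ (σ x) ^ 3 = x := fun x => by
    rw [hσ, hσ, ← pow_mul, ← pow_mul, ← mul_assoc, ← pow_add, ← pow_succ, hF]
  rw [← hσ] at hy
  have hσy : σ y = -y ^ 3 - y := by linear_combination hy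
  have h := hσσ y
  rw [hσy, map_sub, map_neg, map_pow, hσy] at h
  set z := y ^ 3 - y with hz
  have hz9 : z ^ 9 = -z := by
    have e1 : (-(-y ^ 3 - y) ^ 3 - (-y ^ 3 - y)) = y ^ 9 + 2 * y ^ 3 + y := by
      linear_combination (y ^ 7 + y ^ 5) * h0
    have e2 : z ^ 9 = y ^ 27 - y ^ 9 := by
      rw [show z ^ 9 = ((z ^ 3) ^ 3) by ring, hz, hcube, hcube]; ring
    have e3 : (y ^ 9 + 2 * y ^ 3 + y) ^ 3 = y ^ 27 + 2 * y ^ 9 + y ^ 3 := by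
      rw [show y ^ 9 + 2 * y ^ 3 + y = y ^ 9 - (y ^ 3 - y) by linear_combination y ^ 3 * h0,
        hcube, hcube]
      linear_combination (-y ^ 9) * h0
    rw [e1, e3] at h
    rw [e2, hz]
    linear_combination h - y ^ 9 * h0
  -- `z` is fixed by the coprime Frobenius powers 4 and `2 * t + 1`, hence by Frobenius; then `z = z
  -- ^ 9 = -z`.
  have h81 : z ^ 3 ^ 4 = z := by
    rw [show z ^ 3 ^ 4 = (z ^ 9) ^ 9 by ring, hz9, neg_pow, hz9]; ring
  have hgcd : Nat.gcd 4 (t + t + 1) = 1 := by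
    rw [show 4 = 2 ^ 2 by norm_num]
    exact Nat.Coprime.pow_left 2 (Nat.coprime_two_left.2 ⟨t, by ring⟩)
  have hfix := Function.IsPeriodicPt.gcd
    (show Function.IsPeriodicPt (frobenius F 3) 4 z by
      rw [Function.IsPeriodicPt, Function.IsFixedPt, iterate_frobenius, h81])
    (show Function.IsPeriodicPt (frobenius F 3) (t + t + 1) z by
      rw [Function.IsPeriodicPt, Function.IsFixedPt, iterate_frobenius, hF])
  rw [hgcd, Function.IsPeriodicPt, Function.IsFixedPt, iterate_frobenius, pow_one] at hfix
  have hz0 : z = 0 := by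
    have : z ^ 9 = z := by rw [show z ^ 9 = (z ^ 3) ^ 3 by ring, hfix, hfix]
    linear_combination z * h0 + this - hz9
  exact sub_eq_zero.1 hz0

theorem welchT_even (t : ℕ) : welchT (t + t) = t := by
  have : ¬ Odd (t + t) := by rw [Nat.not_odd_iff_even]; exact ⟨t, rfl⟩
  rw [welchT, if_neg this]; omega

theorem welchT_odd (t : ℕ) : welchT (2 * t + 1) = t := by
  rw [welchT, if_pos ⟨t, rfl⟩]; omega

theorem isGAPN_three (n : ℕ) {F : Type*} [Field F] [Finite F] [CharP F 3]
    [Algebra (ZMod 3) F] (hF : ∀ x : F, x ^ 3 ^ n = x) :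
    IsGAPN 3 (fun x : F => x ^ (3 ^ welchT n + 3 + 1)) := by
  intro a ha b
  have h0 : (3 : F) = 0 := CharP.cast_eq_zero F 3
  refine ncard_le_of_sub_eq_smul 3 a _ fun x hx y hy => ?_
  simp only [Set.mem_ofPred_eq, genDeriv_three] at hx hy
  set t := welchT n with ht
  obtain ⟨z, hz⟩ : ∃ z, y = x + z * a := ⟨(y - x) / a, by field_simp; ring⟩
  have hz3 : z ^ 3 ^ t + z ^ 3 + z = 0 := by
    have key : a ^ 3 ^ t * a ^ 3 * a * (z ^ 3 ^ t + z ^ 3 + z) = 0 := by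
      rw [hz, add_pow_char_pow, mul_pow, add_pow_char, mul_pow] at hy
      linear_combination hx - hy
    simpa [ha] using key
  have hc : z ^ 3 = z := by
    rcases Nat.even_or_odd n with ⟨s, rfl⟩ | ⟨s, rfl⟩
    · rw [welchT_even] at ht
      rw [ht] at hz3
      exact cube_eq_self_of_even s hF z hz3
    · rw [welchT_odd] at ht
      rw [ht] at hz3
      exact cube_eq_self_of_odd s (by simpa [two_mul] using hF) z hz3
  have hprod : z * ((z - 1) * (z + 1)) = 0 := by linear_combination hc
  rcases mul_eq_zero.1 hprod with h | h
  · exact ⟨0, by simp [hz, h]⟩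
  rcases mul_eq_zero.1 h with h | h
  · exact ⟨1, by simp [hz, sub_eq_zero.1 h]⟩
  · exact ⟨-1, by rw [hz, eq_neg_of_add_eq_zero_left h]; simp⟩

/-- If `σ` is a square root of the Frobenius endomorphism of a field of characteristic `2`, then
`u ↦ u (σ u + u ^ 2 + 1)` is injective (Dobbertin). -/
theorem injective_of_sqrt_frobenius {F : Type*} [Field F] [CharP F 2] (σ : F →+* F)
    (hσ : ∀ x, σ (σ x) = x ^ 2) : Function.Injective fun u : F => u * (σ u + u ^ 2 + 1) := by
  have h0 : (2 : F) = 0 := CharP.cast_eq_zero F 2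
  intro u v huv
  by_contra hne
  simp only at huv
  obtain ⟨z, hv⟩ : ∃ z, v = u + z := ⟨v - u, by ring⟩
  have hz : z ≠ 0 := by
    rintro rfl
    exact hne (by simp [hv])
  obtain ⟨x, hu⟩ : ∃ x, u = z * x := ⟨u / z, by field_simp⟩
  have hA : x ^ 2 + x + 1 ≠ 0 := by
    intro h
    have hs : (σ x) ^ 2 + σ x + 1 = 0 := by simpa using congrArg σ h
    have hcase : (σ x - x) * (σ x - x - 1) = 0 := by
      linear_combination hs - h + (x ^ 2 + x - σ x - x * σ x) * h0
    have hxx : σ (σ x) = x := by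
      rcases mul_eq_zero.1 hcase with h' | h'
      · rw [sub_eq_zero.1 h', sub_eq_zero.1 h']
      · have e : σ x = x + 1 := by linear_combination h'
        rw [e, map_add, e, map_one]; linear_combination h0
    have h1 : (1 : F) = 0 := by
      rw [hσ] at hxx
      linear_combination h - hxx - x * h0
    exact one_ne_zero h1
  obtain ⟨w, hw⟩ : ∃ w, w = σ x + x + 1 := ⟨_, rfl⟩
  have hW : σ w = x ^ 2 + σ x + 1 := by simp [hw, hσ]
  have hw0 : w ≠ 0 := by
    intro h
    rw [h, map_zero] at hW
    have hprod : x * (x - 1) = 0 := by linear_combination hw - hW - h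
    have hsx : σ x = x := by
      rcases mul_eq_zero.1 hprod with h' | h'
      · simp [h']
      · simp [sub_eq_zero.1 h']
    rw [h, hsx] at hw
    exact one_ne_zero (α := F) (by linear_combination -x * h0 - hw)
  have hAw : x ^ 2 + x + 1 = w + σ w + 1 := by
    rw [hW, hw]; linear_combination -(σ x + 1) * h0
  rw [hAw] at hA
  -- The collision of `u` and `u + z`, divided by `z`.
  have e1 : σ z * w + z ^ 2 * (w + σ w + 1) = 1 := by
    have key : z * (σ z * w + z ^ 2 * (w + σ w + 1) - 1) = 0 := by
      rw [← hAw, hw]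
      rw [hv, hu] at huv
      simp only [map_add, map_mul] at huv
      linear_combination -huv - (z + z ^ 3 * x ^ 2 + z ^ 3 * x) * h0
    simpa [hz, sub_eq_zero] using key
  have e2 : z ^ 2 * σ w + σ z ^ 2 * (σ w + w ^ 2 + 1) = 1 := by
    simpa [hσ] using congrArg σ e1
  -- Eliminating `z ^ 2` from `e1` and `e2` leaves a quadratic in `σ z` that splits in
  -- characteristic 2. Each factor and its `σ`-image, put into `e1`, eliminate `z`.
  have hfac : (σ z * (w + σ w + 1) + 1) * (σ z * (σ w + w ^ 2 + 1) + (w + 1)) = 0 := by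
    linear_combination σ w * e1 - (w + σ w + 1) * e2 +
      (σ z ^ 2 * (w + σ w + 1) * (σ w + w ^ 2 + 1) + σ z * (w ^ 2 + w + σ w + 1)) * h0
  have hfinal : w ^ 2 * σ w = 0 := by
    rcases mul_eq_zero.1 hfac with h | h
    · have h' : z ^ 2 * (σ w + w ^ 2 + 1) + 1 = 0 := by simpa [hσ] using congrArg σ h
      linear_combination w * (σ w + w ^ 2 + 1) * h + (w + σ w + 1) ^ 2 * h' -
        (w + σ w + 1) * (σ w + w ^ 2 + 1) * e1 -
        (σ w ^ 2 + σ w + w ^ 2 + 1 + w * (σ w + w ^ 2 + 1) + w * σ w + w + σ w) * h0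
    · have h' : z ^ 2 * (w ^ 2 + σ w ^ 2 + 1) + (σ w + 1) = 0 := by
        have := congrArg σ h
        simp only [map_add, map_mul, map_pow, map_one, hσ, map_zero] at this
        linear_combination this
      linear_combination w * (w + σ w + 1) * h + (σ w + w ^ 2 + 1) * h' -
        (w + σ w + 1) * (σ w + w ^ 2 + 1) * e1 +
        (z ^ 2 * (σ w + w ^ 2 + 1) * (w * σ w + w + σ w) - w * (w ^ 2 + w + σ w + 1) -
          (σ w + w ^ 2 + 1) * (σ w + 1)) * h0
  simp [hw0] at hfinal

theorem genDeriv_two {F : Type*} [Field F] [Algebra (ZMod 2) F] (f : F → F) (a x : F) :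
    genDeriv 2 f a x = f x + f (x + a) := by
  rw [genDeriv, show (Finset.univ : Finset (ZMod 2)) = {0, 1} by decide,
    Finset.sum_pair (by decide)]
  simp

/-- The Welch power function is almost perfect nonlinear (Dobbertin). -/
theorem isGAPN_two_of_odd (t : ℕ) {F : Type*} [Field F] [Finite F] [CharP F 2]
    [Algebra (ZMod 2) F] (hF : ∀ x : F, x ^ 2 ^ (2 * t + 1) = x) :
    IsGAPN 2 (fun x : F => x ^ (2 ^ t + 2 + 1)) := by
  intro a ha b
  have h0 : (2 : F) = 0 := CharP.cast_eq_zero F 2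
  refine ncard_le_of_sub_eq_smul 2 a _ fun x hx y hy => ?_
  simp only [Set.mem_ofPred_eq, genDeriv_two] at hx hy
  let τ := iterateFrobenius F 2 t
  have hτ : ∀ x, τ x = x ^ 2 ^ t := fun x => iterateFrobenius_def 2 t x
  have hττ : ∀ x, τ (τ x) ^ 2 = x := fun x => by
    rw [hτ, hτ, ← pow_mul, ← pow_mul, ← mul_assoc, ← pow_add, ← pow_succ, ← two_mul, hF]
  let σ : F →+* F := τ.comp (frobenius F 2)
  have hσ : ∀ x, σ x = τ x ^ 2 := fun x => by simp [σ, frobenius_def]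
  have hσσ : ∀ x, σ (σ x) = x ^ 2 := fun x => by
    rw [hσ, hσ, map_pow, hττ]
  obtain ⟨x, rfl⟩ : ∃ x', x = a * x' := ⟨x / a, by field_simp⟩
  obtain ⟨y, rfl⟩ : ∃ y', y = a * y' := ⟨y / a, by field_simp⟩
  -- After scaling by `a`, the derivative depends on `x` only through `τ x + x`.
  have hexp : ∀ x, (a * x) ^ (2 ^ t + 2 + 1) + (a * x + a) ^ (2 ^ t + 2 + 1) =
      a ^ (2 ^ t + 2 + 1) * ((τ x + x) * (σ (τ x + x) + (τ x + x) ^ 2 + 1) + 1) := fun x => by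
    have e : a * x + a = a * (x + 1) := by ring
    have e' : (x + 1) ^ (2 ^ t + 2 + 1) = (τ x + 1) * (x + 1) ^ 3 := by
      rw [add_assoc, pow_add, add_pow_char_pow, one_pow, hτ]
    have e'' : x ^ (2 ^ t + 2 + 1) = τ x * x ^ 3 := by rw [add_assoc, pow_add, hτ]
    have es : σ (τ x + x) = x + τ x ^ 2 := by
      rw [map_add, hσ, hσ, hττ]
    rw [e, mul_pow, mul_pow, e', e'', es, ← mul_add]
    congr 1
    linear_combination (τ x * x ^ 3 + τ x * x ^ 2 + τ x * x + x ^ 2 + x -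
      τ x * (τ x + x) ^ 2) * h0
  rw [hexp] at hx hy
  have hinj := hx.trans hy.symm
  have ha' : a ^ (2 ^ t + 2 + 1) ≠ 0 := pow_ne_zero _ ha
  have hinj' := injective_of_sqrt_frobenius σ hσσ (add_right_cancel (mul_left_cancel₀ ha' hinj))
  have hv : τ (y - x) = y - x := by
    rw [map_sub]; linear_combination -hinj' + (x - y) * h0
  have hv2 : (y - x) ^ 2 = y - x := by
    have := hττ (y - x)
    rwa [hv, hv] at this
  have hprod : (y - x) * (y - x - 1) = 0 := by linear_combination hv2
  rcases mul_eq_zero.1 hprod with h | h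
  · exact ⟨0, by simp [sub_eq_zero.1 h]⟩
  · exact ⟨1, by rw [one_smul]; linear_combination a * h⟩

/-- Since 3 divides `4 ^ m - 1`, there is `ω` with `ω ^ 2 + ω + 1 = 0`; for `a = b = 1` the points
0, 1, `ω` are all solutions, whatever `t` is. -/
theorem not_isGAPN_two_of_even (n t : ℕ) (hn : Even n) (hn0 : n ≠ 0) {F : Type*} [Field F]
    [Finite F] [CharP F 2] [Algebra (ZMod 2) F] (hF : Nat.card F = 2 ^ n) :
    ¬ IsGAPN 2 (fun x : F => x ^ (2 ^ t + 2 + 1)) := by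
  intro h
  have h0 : (2 : F) = 0 := CharP.cast_eq_zero F 2
  have hdvd : 3 ∣ Nat.card Fˣ := by
    rw [Nat.card_units, hF]
    obtain ⟨m, rfl⟩ := hn
    rw [← two_mul, pow_mul]
    simpa using Nat.sub_dvd_pow_sub_pow 4 1 m
  have : Fact (Nat.Prime 3) := ⟨Nat.prime_three⟩
  obtain ⟨g, hg⟩ := exists_prime_orderOf_dvd_card' 3 hdvd
  have hω3 : (g : F) ^ 3 = 1 := by
    rw [← Units.val_pow_eq_pow_val, ← hg, pow_orderOf_eq_one, Units.val_one]
  have hω1 : (g : F) ≠ 1 := by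
    intro h'
    rw [Units.val_eq_one.1 h', orderOf_one] at hg
    omega
  obtain ⟨ω, hω⟩ : ∃ ω : F, ω = g := ⟨_, rfl⟩
  rw [← hω] at hω3 hω1
  have hω0 : ω ≠ 0 := hω ▸ g.ne_zero
  have hq : ω ^ 2 + ω + 1 = 0 := by
    have : (ω - 1) * (ω ^ 2 + ω + 1) = 0 := by linear_combination hω3
    simpa [sub_eq_zero, hω1] using this
  have hsub : ({0, 1, ω} : Set F) ⊆
      {x : F | genDeriv 2 (fun x : F => x ^ (2 ^ t + 2 + 1)) 1 x = 1} := by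
    rintro x (rfl | rfl | hx)
    · simp [genDeriv_two]
    · simp [genDeriv_two, one_add_one_eq_two, h0]
    · rw [Set.mem_singleton_iff.1 hx]
      have e : ω + 1 = ω ^ 2 := by linear_combination hq - ω ^ 2 * h0
      have e3 : ω ^ (2 ^ t + 2 + 1) = ω ^ 2 ^ t := by
        rw [add_assoc, pow_add, hω3, mul_one]
      simp only [Set.mem_ofPred_eq, genDeriv_two]
      rw [e, pow_right_comm, e3, ← pow_right_comm, ← add_pow_char_pow,
        show ω + ω ^ 2 = 1 by linear_combination hq - h0, one_pow]
  have hcard : ({0, 1, ω} : Set F).ncard = 3 :=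
    Set.ncard_eq_three.2 ⟨0, 1, ω, zero_ne_one, hω0.symm, hω1.symm, rfl⟩
  have h1 := Set.ncard_le_ncard hsub (Set.toFinite _)
  have h2 := h 1 one_ne_zero 1
  omega

theorem not_isGAPN_of_five_le (p n t : ℕ) [Fact p.Prime] (hp : 5 ≤ p) (hn : 2 ≤ n)
    {F : Type*} [Field F] [Finite F] [CharP F p] [Algebra (ZMod p) F]
    (hF : Nat.card F = p ^ n) : ¬ IsGAPN p (fun x : F => x ^ (p ^ t + p + 1)) := by
  intro h
  have h1 := h 1 one_ne_zero 0
  simp only [genDeriv_eq_zero_of_five_le p hp, Set.ofPred_true, Set.ncard_univ, hF] at h1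
  have h2 : p ^ 1 < p ^ n := Nat.pow_lt_pow_right (by omega) (by omega)
  rw [pow_one] at h2
  omega

theorem mainTheorem4 (p n : ℕ) [Fact p.Prime] (hn : 2 ≤ n)
    (F : Type*) [Field F] [Finite F] [Algebra (ZMod p) F] (hF : Nat.card F = p ^ n) :
    IsGAPN p (fun x : F => x ^ (p ^ welchT n + p + 1)) ↔ (p = 2 ∧ Odd n) ∨ p = 3 := by
  have : CharP F p := charP_of_injective_algebraMap (algebraMap (ZMod p) F).injective p
  have hpow : ∀ x : F, x ^ p ^ n = x := fun x => by
    have := Fintype.ofFinite F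
    rw [← hF, Nat.card_eq_fintype_card, FiniteField.pow_card]
  have hprime : p.Prime := Fact.out
  rcases lt_or_ge p 5 with hlt | hge
  · have hp : p = 2 ∨ p = 3 := by
      have := hprime.two_le
      interval_cases p <;> first | omega | (exfalso; revert hprime; decide)
    rcases hp with rfl | rfl
    · rcases Nat.even_or_odd n with he | ho
      · have hno : ¬ Odd n := Nat.not_odd_iff_even.2 he
        simpa [hno] using not_isGAPN_two_of_even n (welchT n) he (by omega) hF
      · obtain ⟨t, rfl⟩ := ho
        rw [welchT_odd]
        exact iff_of_true (isGAPN_two_of_odd t hpow) (Or.inl ⟨rfl, t, rfl⟩)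
    · exact iff_of_true (isGAPN_three n hpow) (Or.inr rfl)
  · refine iff_of_false (not_isGAPN_of_five_le p n _ hge hn hF) ?_
    omega
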